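/- Let $d\ge 3$, let $\mathcal T$ be a $d$-regular tree, and let $\mathrm{Aut}(\mathcal T)$ carry the topology of pointwise convergence on vertices. Let $\iota$ be a legal coloring of $\mathcal T$: a map from the set of unoriented edges of $\mathcal T$ to $\{1,\dots,d\}$ whose restriction to the star $E(x)$ (the set of edges containing $x$) of every vertex $x$ is a bijection onto $\{1,\dots,d\}$. Let $F\le \mathrm{Sym}\{1,\dots,d\}$ be a primitive permutation group. Let $$U(F)=\{g\in \mathrm{Aut}(\mathcal T) : \iota\circ g\circ(\iota|_{E(x)})^{-1}\in F \text{ for every vertex } x\},$$ and let $\mathbb G=U(F)^+$ be the subgroup generated by those elements of $U(F)$ that fix both endpoints of some edge of $\mathcal T$, with the subspace topology. Let $a\in\mathbb G$ be hyperbolic, i.e. $a$ fixes no vertex and inverts no edge of $\mathcal T$. Put $$U_a^+=\{g\in\mathbb G : \lim_{n\to\infty}a^{-n}ga^{n}=e\},\qquad U_a^-=\{g\in\mathbb G : \lim_{n\to\infty}a^{n}ga^{-n}=e\}.$$ Then $\mathbb G=\langle U_a^+,U_a^-\rangle$. Moreover, for every (strongly continuous) unitary representation $(\pi,\mathcal H)$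 of $\mathbb G$ on a complex Hilbert space without non-zero $\mathbb G$-invariant vectors, and for all $v,w\in\mathcal H$, one has $\langle \pi(a^n)v,w\rangle\to 0$ as $n\to\infty$. -/

import Mathlib

open Filter Topology

namespace BurgerMozes

variable {V : Type*} {T : SimpleGraph V} {d : ℕ}

/-- The topology of pointwise convergence on the automorphism group of a graph (the vertex set
being discrete): basic neighbourhoods of `g` are the sets of automorphisms that agree with `g`
on a given finite set of vertices. -/
instance autTopology : TopologicalSpace (T ≃g T) :=
  TopologicalSpace.induced (fun g : T ≃g T => (g : V → V))
    (@Pi.topologicalSpace V (fun _ => V) (fun _ => ⊥))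

/-- The star of the vertex `x`: the set of (unoriented) edges containing `x`. -/
def edgeStar (T : SimpleGraph V) (x : V) : Set T.edgeSet := {e | x ∈ (e : Sym2 V)}

/-- A legal coloring: a coloring of the unoriented edges by `d` colors whose restriction to the
star of every vertex is a bijection onto the set of colors. -/
def IsLegalColoring (ι : T.edgeSet → Fin d) : Prop :=
  ∀ x : V, Set.BijOn ι (edgeStar T x) Set.univ

/-- The universal group `U(F)`: the automorphisms `g` such that for every vertex `x` the map
`ι ∘ g ∘ (ι|_{E(x)})⁻¹` is (given by) a permutation `σ ∈ F`, i.e. `ι (g e) = σ (ι e)` for all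
edges `e` in the star `E(x)`. -/
def universalGroup (ι : T.edgeSet → Fin d) (F : Subgroup (Equiv.Perm (Fin d))) :
    Subgroup (T ≃g T) where
  carrier := {g | ∀ x : V, ∃ σ ∈ F, ∀ e ∈ edgeStar T x, ι (g.mapEdgeSet e) = σ (ι e)}
  one_mem' := by
    intro x
    refine ⟨1, F.one_mem, fun e _ => ?_⟩
    have h : (1 : T ≃g T).mapEdgeSet e = e := by
      obtain ⟨e, he⟩ := e
      induction e with | _ u v => rfl
    rw [h]; rfl
  mul_mem' := by
    intro g h hg hh x
    obtain ⟨σ, hσ, h1⟩ := hh x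
    obtain ⟨τ, hτ, h2⟩ := hg (h x)
    refine ⟨τ * σ, F.mul_mem hτ hσ, fun e he => ?_⟩
    have h3 : (g * h).mapEdgeSet e = g.mapEdgeSet (h.mapEdgeSet e) := by
      obtain ⟨e, he⟩ := e
      induction e with | _ u v => rfl
    have h4 : h.mapEdgeSet e ∈ edgeStar T (h x) := Sym2.mem_map.2 ⟨x, he, rfl⟩
    rw [h3, h2 _ h4, h1 _ he]; rfl
  inv_mem' := by
    intro g hg x
    obtain ⟨σ, hσ, h1⟩ := hg (g⁻¹ x)
    refine ⟨σ⁻¹, F.inv_mem hσ, fun e he => ?_⟩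
    have h2 : g⁻¹.mapEdgeSet e ∈ edgeStar T (g⁻¹ x) := Sym2.mem_map.2 ⟨x, he, rfl⟩
    have h3 : g.mapEdgeSet (g⁻¹.mapEdgeSet e) = e := g.mapEdgeSet.apply_symm_apply e
    have h4 := h1 _ h2
    rw [h3] at h4
    rw [h4]; exact (σ.symm_apply_apply _).symm

/-- The group `U(F)⁺`: the subgroup generated by the elements of `U(F)` that stabilize some edge
(fixing both of its endpoints). -/
def universalGroupPlus (ι : T.edgeSet → Fin d) (F : Subgroup (Equiv.Perm (Fin d))) :
    Subgroup (T ≃g T) :=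
  Subgroup.closure {g | g ∈ universalGroup ι F ∧ ∃ x y : V, T.Adj x y ∧ g x = x ∧ g y = y}

/-- An automorphism of a tree is hyperbolic if it has no fixed point in the geometric realization
of the tree, i.e. it fixes no vertex and inverts no edge. -/
def IsHyperbolic (g : T ≃g T) : Prop :=
  (∀ x : V, g x ≠ x) ∧ ∀ x y : V, T.Adj x y → ¬ (g x = y ∧ g y = x)

/-- The contraction group `U⁺_α = {g | αₙ⁻¹ g αₙ → e}` of a sequence `α`, as a set. -/
def contractionPlus {G : Type*} [Group G] [TopologicalSpace G] (α : ℕ → G) : Set G :=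
  {g | Tendsto (fun n => (α n)⁻¹ * g * α n) atTop (𝓝 1)}

/-- The contraction group `U⁻_α = {g | αₙ g αₙ⁻¹ → e}` of a sequence `α`, as a set. -/
def contractionMinus {G : Type*} [Group G] [TopologicalSpace G] (α : ℕ → G) : Set G :=
  {g | Tendsto (fun n => α n * g * (α n)⁻¹) atTop (𝓝 1)}

/-- A group homomorphism into the unitary group of a complex Hilbert space is a unitary
representation if it is strongly continuous. -/
def IsUnitaryRep {G H : Type*} [Group G] [TopologicalSpace G] [NormedAddCommGroup H]
    [InnerProductSpace ℂ H] (π : G →* (H ≃ₗᵢ[ℂ] H)) : Prop :=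
  ∀ v : H, Continuous fun g : G => π g v

end BurgerMozes

/-!
The second assertion is the Mautner phenomenon. Along an ultrafilter, `π (a ^ n)` and `π (a ^ n)⁻¹`
converge weakly to operators `E` and `E'` adjoint to each other; `E` is normal because the powers
of `a` commute. The range of `E` is fixed by `U⁺_a` and that of `E'` by `U⁻_a`, so the range of
`E' E = E E'` is fixed by the group generated by both, hence is zero if that group is everything
and there are no invariant vectors. Then `‖E v‖² = ⟨v, E' E v⟩ = 0`; see
`tendsto_inner_rep_pow_zero`.

That `U⁺_a` and `U⁻_a` generate `U(F)⁺` is `closure_contraction_eq_top`. A hyperbolic `a` translates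
a non-backtracking line (`IsHyperbolic.exists_axis`). By independence
(`exists_mem_universalGroup_eqOn_halfTree`), the fixator in `U(F)` of an edge of this line is the
product of the fixators of the two half-trees of that edge, and these lie in `U⁺_a` and `U⁻_a`
because the powers of `a` push the half-trees over the whole tree. So the generated group `N`
contains the edge fixators along the axis. Two consecutive axis edges have different colours
`c₁ ≠ c₂`, and the stabilizers `F_{c₁}`, `F_{c₂}` are maximal in the primitive group `F`; they
generate `F` unless `F` acts freely (`le_of_stabilizers_le_or_eq_one`), and in the free case `U(F)⁺`
is trivial and contains no hyperbolic element. Hence `N` acts transitively on the star of every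
axis vertex, every edge is an `N`-translate of an axis edge, and `N` contains all edge fixators
(`mem_of_fix_edge`), which generate `U(F)⁺` by definition.
-/

namespace BurgerMozes

/-! ### Contraction groups and matrix coefficients -/

section Mautner

variable {H : Type*} [NormedAddCommGroup H] [InnerProductSpace ℂ H]
  {G : Type*} [Group G]

lemma inner_rep_left (π : G →* (H ≃ₗᵢ[ℂ] H)) (g : G) (v w : H) :
    inner ℂ (π g v) w = inner ℂ v (π g⁻¹ w) := by
  rw [← (π g⁻¹).inner_map_map (π g v) w]
  congr 1
  change (π g⁻¹ * π g) v = v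
  rw [← map_mul]; simp

lemma rep_mul_apply (π : G →* (H ≃ₗᵢ[ℂ] H)) (g h : G) (v : H) :
    π (g * h) v = π g (π h v) := by
  rw [map_mul]; rfl

variable [TopologicalSpace G]

lemma IsUnitaryRep.tendsto_norm_sub {π : G →* (H ≃ₗᵢ[ℂ] H)} (hπ : IsUnitaryRep π) {α : Type*}
    {l : Filter α} {g : α → G} (hg : Tendsto g l (𝓝 1)) (v : H) :
    Tendsto (fun n => ‖π (g n) v - v‖) l (𝓝 0) := by
  have h := (((hπ v).tendsto 1).comp hg).sub_const v
  simpa using h.norm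

/-- A weak limit of `π (α n) v` is fixed by every `u` with `(α n)⁻¹ u (α n) → 1`, since
`π u (π (α n) v) = π (α n) (π ((α n)⁻¹ u (α n)) v)`. -/
lemma rep_weak_limit_of_mem_contractionPlus {π : G →* (H ≃ₗᵢ[ℂ] H)} (hπ : IsUnitaryRep π)
    {α : ℕ → G} {u : G} (hu : u ∈ contractionPlus α) {l : Filter ℕ} [l.NeBot] (hl : l ≤ atTop)
    {v y : H} (hy : ∀ w : H, Tendsto (fun n => inner ℂ (π (α n) v) w) l (𝓝 (inner ℂ y w))) :
    π u y = y := by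
  refine ext_inner_right ℂ fun w => ?_
  have h1 : Tendsto (fun n => inner ℂ (π u (π (α n) v)) w) l (𝓝 (inner ℂ (π u y) w)) := by
    simp only [inner_rep_left π u]
    exact hy _
  refine tendsto_nhds_unique h1 ?_
  have h2 : Tendsto (fun n => inner ℂ (π u (π (α n) v) - π (α n) v) w) l (𝓝 0) := by
    refine squeeze_zero_norm (a := fun n => ‖π ((α n)⁻¹ * u * α n) v - v‖ * ‖w‖) (fun n => ?_) ?_
    · refine (norm_inner_le_norm _ _).trans (le_of_eq ?_)
      congr 1
      rw [← rep_mul_apply, ← (π (α n)).norm_map (π ((α n)⁻¹ * u * α n) v - v), map_sub,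
        ← rep_mul_apply]
      congr 4
      group
    · simpa using (hπ.tendsto_norm_sub (Tendsto.mono_left hu hl) v).mul_const ‖w‖
  simpa [inner_sub_left] using h2.add (hy w)

variable [CompleteSpace H]

/-- Bounded sequences in a Hilbert space converge weakly along every ultrafilter. -/
lemma exists_weak_limit {α : Type*} (𝒰 : Ultrafilter α) (x : α → H) (C : ℝ)
    (hx : ∀ n, ‖x n‖ ≤ C) :
    ∃ y : H, ∀ w : H, Tendsto (fun n => inner ℂ (x n) w) 𝒰 (𝓝 (inner ℂ y w)) := by
  have hb : ∀ w n, ‖inner ℂ (x n) w‖ ≤ C * ‖w‖ := fun w n =>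
    (norm_inner_le_norm _ _).trans (mul_le_mul_of_nonneg_right (hx n) (norm_nonneg w))
  have key : ∀ w : H, ∃ c : ℂ, ‖c‖ ≤ C * ‖w‖ ∧
      Tendsto (fun n => inner ℂ (x n) w) 𝒰 (𝓝 c) := by
    intro w
    obtain ⟨c, hc, hlim⟩ := (isCompact_closedBall (0 : ℂ) (C * ‖w‖)).ultrafilter_le_nhds
      (𝒰.map fun n => inner ℂ (x n) w) (by
        rw [Ultrafilter.coe_map, le_principal_iff, mem_map]
        exact Eventually.of_forall fun n => by simpa using hb w n)
    exact ⟨c, by simpa using hc, hlim⟩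
  choose f hf hlim using key
  let ℓ : H →ₗ[ℂ] ℂ :=
    { toFun := f
      map_add' := fun u v => tendsto_nhds_unique (hlim (u + v)) (by
        simpa [inner_add_right] using (hlim u).add (hlim v))
      map_smul' := fun c v => tendsto_nhds_unique (hlim (c • v)) (by
        simpa [inner_smul_right] using (hlim v).const_mul c) }
  refine ⟨(InnerProductSpace.toDual ℂ H).symm (ℓ.mkContinuous C hf), fun w => ?_⟩
  rw [InnerProductSpace.toDual_symm_apply]
  exact hlim w

/-- Mautner phenomenon: if `G` is generated by the contraction groups of `a`, then the matrix
coefficients `⟨π (a ^ n) v, w⟩` of a unitary representation without invariant vectors tend to `0`.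
-/
theorem tendsto_inner_rep_pow_zero {π : G →* (H ≃ₗᵢ[ℂ] H)} (hπ : IsUnitaryRep π) (a : G)
    (hgen : Subgroup.closure (contractionPlus (fun n : ℕ => a ^ n) ∪
        contractionMinus (fun n : ℕ => a ^ n)) = ⊤)
    (hinv : ∀ v : H, (∀ g : G, π g v = v) → v = 0) (v w : H) :
    Tendsto (fun n : ℕ => inner ℂ (π (a ^ n) v) w) atTop (𝓝 0) := by
  rw [tendsto_iff_ultrafilter]
  intro 𝒰 h𝒰
  have hE : ∀ v : H, ∃ y : H, ∀ w : H,
      Tendsto (fun n : ℕ => inner ℂ (π (a ^ n) v) w) 𝒰 (𝓝 (inner ℂ y w)) := fun v =>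
    exists_weak_limit 𝒰 _ ‖v‖ fun n => by simp
  have hE' : ∀ v : H, ∃ y : H, ∀ w : H,
      Tendsto (fun n : ℕ => inner ℂ (π (a ^ n)⁻¹ v) w) 𝒰 (𝓝 (inner ℂ y w)) := fun v =>
    exists_weak_limit 𝒰 _ ‖v‖ fun n => by simp
  choose E hE using hE
  choose E' hE' using hE'
  have swap : ∀ {x : ℕ → H} {y z : H},
      Tendsto (fun n => inner ℂ (x n) z) 𝒰 (𝓝 (inner ℂ y z)) →
      Tendsto (fun n => inner ℂ z (x n)) 𝒰 (𝓝 (inner ℂ z y)) := fun {x y z} h => by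
    have := (Complex.continuous_conj.tendsto _).comp h
    simpa [Function.comp_def, inner_conj_symm] using this
  have adj : ∀ v w : H, inner ℂ (E v) w = inner ℂ v (E' w) := fun v w =>
    tendsto_nhds_unique (hE v w) (by
      simp only [inner_rep_left π]
      exact swap (hE' w v))
  -- the limit operator `E` is normal, because the powers of `a` commute
  have normal : ∀ v w : H, inner ℂ (E v) (E w) = inner ℂ (E' v) (E' w) := by
    intro v w
    refine tendsto_nhds_unique (hE v (E w)) ?_
    have : ∀ n : ℕ, inner ℂ (π (a ^ n) v) (E w) = inner ℂ (E' v) (π (a ^ n)⁻¹ w) := by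
      intro n
      refine tendsto_nhds_unique (swap (hE w (π (a ^ n) v))) ?_
      have h := hE' v (π (a ^ n)⁻¹ w)
      refine h.congr fun m => ?_
      rw [inner_rep_left π, inner_rep_left π, ← rep_mul_apply, ← rep_mul_apply]
      congr 3
      rw [inv_inv, ← inv_pow]
      exact ((Commute.refl a).inv_right.pow_pow m n)
    simp only [this]
    exact swap (hE' w (E' v))
  have hplus : ∀ u ∈ contractionPlus (fun n : ℕ => a ^ n), ∀ v, π u (E v) = E v := fun u hu v =>
    rep_weak_limit_of_mem_contractionPlus hπ hu h𝒰 (hE v)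
  have hminus : ∀ u ∈ contractionMinus (fun n : ℕ => a ^ n), ∀ v, π u (E' v) = E' v :=
    fun u hu v => rep_weak_limit_of_mem_contractionPlus (α := fun n : ℕ => (a ^ n)⁻¹) hπ
      (by simpa [contractionPlus, contractionMinus] using hu) h𝒰 (hE' v)
  -- hence `E' E = E E'` has its range fixed by both contraction groups
  have hfix : ∀ v, E' (E v) = 0 := by
    intro v
    refine hinv _ fun g => ?_
    have hg : g ∈ Subgroup.closure (contractionPlus (fun n : ℕ => a ^ n) ∪
        contractionMinus (fun n : ℕ => a ^ n)) := hgen ▸ Subgroup.mem_top g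
    induction hg using Subgroup.closure_induction with
    | mem u hu =>
      rcases hu with hu | hu
      · refine ext_inner_right ℂ fun w => ?_
        have hE'u : E' (π u⁻¹ w) = E' w := by
          refine ext_inner_left ℂ fun z => ?_
          rw [← adj, ← adj, ← inner_rep_left, hplus u hu]
        have hflip : ∀ z, inner ℂ (E' (E v)) z = inner ℂ (E v) (E z) := fun z => by
          rw [← inner_conj_symm, ← adj, inner_conj_symm]
        rw [inner_rep_left, hflip, hflip, normal, normal, hE'u]
      · exact hminus u hu _
    | one => simp
    | mul g h _ _ hg hh => rw [rep_mul_apply, hh, hg]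
    | inv g _ hg =>
      conv_lhs => rw [← hg]
      rw [← rep_mul_apply]; simp
  have hEv : E v = 0 := by
    rw [← inner_self_eq_zero (𝕜 := ℂ), adj, hfix, inner_zero_right]
  simpa [hEv] using hE v w

end Mautner

variable {V : Type*} {T : SimpleGraph V} {d : ℕ}

/-! ### Distances and half-trees in a tree -/

section Trees

lemma exists_adj_dist_eq_add_one (hT : T.IsTree) {s v : V} (h : s ≠ v) :
    ∃ w, T.Adj v w ∧ T.dist s v = T.dist s w + 1 := by
  obtain ⟨p, hp⟩ := hT.connected.exists_walk_length_eq_dist v s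
  cases p with
  | nil => exact absurd rfl h
  | @cons _ w _ hvw q =>
    refine ⟨w, hvw, ?_⟩
    have h1 := T.dist_le q
    rw [SimpleGraph.Walk.length_cons, T.dist_comm] at hp
    rw [T.dist_comm (u := w)] at h1
    rcases hT.dist_eq_dist_add_one_of_adj s hvw with h | h <;> omega

lemma eq_of_adj_of_dist_eq_add_one (hT : T.IsTree) {s v w w' : V} (hw : T.Adj v w)
    (hw' : T.Adj v w') (h : T.dist s v = T.dist s w + 1) (h' : T.dist s v = T.dist s w' + 1) :
    w = w' := by
  have key : ∀ u, T.Adj v u → T.dist s v = T.dist s u + 1 →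
      ∃ p : T.Walk s v, p.IsPath ∧ p.penultimate = u := by
    intro u hu h
    obtain ⟨p, hp⟩ := hT.connected.exists_walk_length_eq_dist s u
    refine ⟨p.concat hu.symm, ?_, by simp⟩
    apply SimpleGraph.Walk.isPath_of_length_eq_dist
    rw [SimpleGraph.Walk.length_concat, hp, h]
  obtain ⟨p, hp, rfl⟩ := key w hw h
  obtain ⟨q, hq, rfl⟩ := key w' hw' h'
  rw [(hT.existsUnique_path s v).unique hp hq]

/-- For adjacent `x` and `y`, the vertex set of the component of `y` in the tree with the edge
`{x, y}` removed, encoded as the set of vertices closer to `y` than to `x`. -/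
def halfTree (T : SimpleGraph V) (x y : V) : Set V := {v | T.dist v y < T.dist v x}

lemma mem_halfTree {x y v : V} : v ∈ halfTree T x y ↔ T.dist v y < T.dist v x := Iff.rfl

lemma notMem_halfTree_iff (hT : T.IsTree) {x y : V} (hxy : T.Adj x y) {v : V} :
    v ∉ halfTree T x y ↔ v ∈ halfTree T y x := by
  have := hT.dist_ne_of_adj v hxy
  simp only [mem_halfTree]; omega

lemma dist_apply (g : T ≃g T) (hT : T.IsTree) (u v : V) : T.dist (g u) (g v) = T.dist u v := by
  have key : ∀ (g : T ≃g T) (u v : V), T.dist (g u) (g v) ≤ T.dist u v := by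
    intro g u v
    obtain ⟨p, hp⟩ := hT.connected.exists_walk_length_eq_dist u v
    rw [← hp, ← p.length_map g.toHom]
    exact T.dist_le _
  refine le_antisymm (key g u v) ?_
  simpa using key g.symm (g u) (g v)

lemma apply_mem_halfTree_iff (hT : T.IsTree) (g : T ≃g T) {x y v : V} :
    g v ∈ halfTree T (g x) (g y) ↔ v ∈ halfTree T x y := by
  simp only [mem_halfTree, dist_apply g hT]

/-- The only edge leaving a half-tree is the one that defines it. -/
lemma eq_and_eq_of_adj_of_mem_halfTree (hT : T.IsTree) {x y v w : V} (hxy : T.Adj x y)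
    (hvw : T.Adj v w) (hv : v ∈ halfTree T x y) (hw : w ∉ halfTree T x y) : v = y ∧ w = x := by
  rw [mem_halfTree] at hv hw
  have e1 := hT.dist_eq_dist_add_one_of_adj v hxy
  have e2 := hT.dist_eq_dist_add_one_of_adj w hxy
  have e3 := hT.dist_eq_dist_add_one_of_adj x hvw
  have e4 := hT.dist_eq_dist_add_one_of_adj y hvw
  simp only [T.dist_comm (u := x), T.dist_comm (u := y)] at e3 e4
  have hvy : v = y := by
    by_contra hne
    obtain ⟨v', hvv', h1⟩ := exists_adj_dist_eq_add_one hT (Ne.symm hne)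
    have e5 := hT.dist_eq_dist_add_one_of_adj x hvv'
    have e6 := hT.dist_eq_dist_add_one_of_adj v' hxy
    simp only [T.dist_comm (u := x), T.dist_comm (u := y)] at e5 h1
    have : v' = w := by
      refine eq_of_adj_of_dist_eq_add_one hT (s := x) hvv' hvw ?_ ?_ <;>
      simp only [T.dist_comm (u := x)] <;> omega
    subst this
    omega
  refine ⟨hvy, ?_⟩
  subst hvy
  rw [T.dist_self] at e1 e4 hv
  have h0 : T.dist w x = 0 := by omega
  exact hT.connected.dist_eq_zero_iff.1 h0

variable {x : ℤ → V}

lemma dist_add_two_of_dist_add_one (hT : T.IsTree) (hadj : ∀ k, T.Adj (x k) (x (k + 1)))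
    (hne : ∀ k, x k ≠ x (k + 2)) {s : V} {k : ℤ}
    (h : T.dist s (x (k + 1)) = T.dist s (x k) + 1) :
    T.dist s (x (k + 1 + 1)) = T.dist s (x (k + 1)) + 1 := by
  rcases hT.dist_eq_dist_add_one_of_adj s (hadj (k + 1)) with h' | h'
  · refine absurd (eq_of_adj_of_dist_eq_add_one hT (hadj k).symm (hadj (k + 1)) h h') ?_
    rw [add_assoc]
    exact hne k
  · exact h'

/-- Along a non-backtracking line, the distance to a fixed vertex is eventually increasing. -/
lemma exists_forall_mem_halfTree (hT : T.IsTree) (hadj : ∀ k, T.Adj (x k) (x (k + 1)))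
    (hne : ∀ k, x k ≠ x (k + 2)) (s : V) :
    ∃ K : ℤ, ∀ k ≥ K, s ∈ halfTree T (x (k + 1)) (x k) := by
  have hinc : ∃ K : ℤ, T.dist s (x (K + 1)) = T.dist s (x K) + 1 := by
    by_contra! hcon
    have hdec : ∀ n : ℕ, T.dist s (x n) + n = T.dist s (x 0) := by
      intro n
      induction n with
      | zero => simp
      | succ n ih =>
        have := (hT.dist_eq_dist_add_one_of_adj s (hadj n)).resolve_right (hcon n)
        push_cast
        omega
    have := hdec (T.dist s (x 0) + 1)
    omega
  obtain ⟨K, hK⟩ := hinc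
  refine ⟨K, fun k hk => ?_⟩
  have : T.dist s (x (k + 1)) = T.dist s (x k) + 1 := by
    induction k, hk using Int.leInduction with
    | base => exact hK
    | succ k _ ih => exact dist_add_two_of_dist_add_one hT hadj hne ih
  rw [mem_halfTree]
  omega

end Trees

/-! ### The axis of a hyperbolic automorphism -/

section Axis

/-- A hyperbolic automorphism translates a bi-infinite non-backtracking line: the `a`-translates
of a walk from `x` to `a x`, where `x` has minimal displacement. -/
lemma IsHyperbolic.exists_axis (hT : T.IsTree) {a : T ≃g T} (ha : IsHyperbolic a) :
    ∃ (x : ℤ → V) (l : ℤ), 0 < l ∧ (∀ k, T.Adj (x k) (x (k + 1))) ∧ (∀ k, x k ≠ x (k + 2)) ∧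
      ∀ k, a (x k) = x (k + l) := by
  have : Nonempty V := hT.connected.nonempty
  obtain ⟨x₀, hmin⟩ : ∃ x₀, ∀ v, T.dist x₀ (a x₀) ≤ T.dist v (a v) :=
    ⟨Function.argmin (fun v => T.dist v (a v)), fun v =>
      Function.argmin_le (fun v => T.dist v (a v)) v⟩
  obtain ⟨p, hp⟩ := hT.connected.exists_walk_length_eq_dist x₀ (a x₀)
  have hlpos : 0 < p.length := by
    rw [hp]
    exact hT.connected.pos_dist_of_ne (ha.1 x₀).symm
  set l := p.length with hl
  let x : ℤ → V := fun k => (a ^ (k / l)) (p.getVert (k % l).toNat)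
  have hmul : ∀ (q : ℤ) (v : V), (a ^ (q + 1)) v = (a ^ q) (a v) := fun q v => by
    rw [zpow_add_one]; rfl
  have hx : ∀ (q : ℤ) (r : ℕ), r ≤ l → x (q * l + r) = (a ^ q) (p.getVert r) := by
    intro q r hr
    rcases hr.lt_or_eq with hr | rfl
    · have h1 : (q * l + r) / (l : ℤ) = q := by
        rw [add_comm, Int.add_mul_ediv_right _ _ (by omega),
          Int.ediv_eq_zero_of_lt (by omega) (by omega), zero_add]
      have h2 : (q * l + r) % (l : ℤ) = r := by
        rw [add_comm, Int.add_mul_emod_self_right, Int.emod_eq_of_lt (by omega) (by omega)]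
      simp only [x, h1, h2, Int.toNat_natCast]
    · have h1 : (q * l + l) / (l : ℤ) = q + 1 := by
        rw [← add_one_mul, Int.mul_ediv_cancel _ (by omega)]
      have h2 : (q * l + l) % (l : ℤ) = 0 := by
        rw [← add_one_mul, Int.mul_emod_left]
      simp only [x, h1, h2, Int.toNat_zero, SimpleGraph.Walk.getVert_zero, hmul]
      rw [hl, SimpleGraph.Walk.getVert_length]
  have hdecomp : ∀ k : ℤ, ∃ (q : ℤ) (r : ℕ), r < l ∧ k = q * l + r := by
    intro k
    have h0 := Int.emod_nonneg k (b := l) (by omega)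
    have h1 := Int.emod_lt_of_pos k (b := l) (by omega)
    have h2 := Int.mul_ediv_add_emod k l
    refine ⟨k / l, (k % l).toNat, by omega, ?_⟩
    rw [Int.toNat_of_nonneg h0, mul_comm]
    exact h2.symm
  have hadj : ∀ k, T.Adj (x k) (x (k + 1)) := by
    intro k
    obtain ⟨q, r, hr, rfl⟩ := hdecomp k
    have h1 := hx q (r + 1) hr
    push_cast at h1
    rw [add_assoc, h1, hx q r hr.le]
    exact (a ^ q).map_rel_iff.2 (p.adj_getVert_succ hr)
  have hshift : ∀ k, a (x k) = x (k + l) := by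
    intro k
    obtain ⟨q, r, hr, rfl⟩ := hdecomp k
    have h1 := hx (q + 1) r hr.le
    rw [show q * l + r + l = (q + 1) * (l : ℤ) + r by ring, h1, hx q r hr.le, add_comm q,
      zpow_one_add]
    rfl
  have hdist : ∀ (k : ℤ) (n : ℕ), T.dist (x k) (x (k + n)) ≤ n := by
    intro k n
    induction n with
    | zero => simp
    | succ n ih =>
      have h1 := hT.connected.dist_triangle (u := x k) (v := x (k + n)) (w := x (k + n + 1))
      have h2 := SimpleGraph.dist_eq_one_iff_adj.2 (hadj (k + n))
      push_cast
      rw [← add_assoc]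
      omega
  refine ⟨x, l, by omega, hadj, fun k hk => ?_, hshift⟩
  -- Backtracking would give a vertex of smaller displacement, or an inverted edge if `l = 1`.
  rcases Nat.lt_or_ge 1 l with h2 | h1
  · have h3 := hdist (k + 2) (l - 2)
    rw [← hk, show k + 2 + ((l - 2 : ℕ) : ℤ) = k + l by omega, ← hshift] at h3
    have h4 := hmin (x k)
    omega
  · have h1 : (l : ℤ) = 1 := by omega
    rw [h1] at hshift
    refine ha.2 _ _ (hadj k) ⟨hshift k, ?_⟩
    rw [hshift, hk, add_assoc]
    rfl

end Axis

/-! ### Neighbours along colours and the universal group -/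

section Coloring

variable {ι : T.edgeSet → Fin d} {F : Subgroup (Equiv.Perm (Fin d))}

lemma IsLegalColoring.exists_neighbor (hι : IsLegalColoring ι) (x : V) (c : Fin d) :
    ∃ y, ∃ h : T.Adj x y, ι ⟨s(x, y), h⟩ = c := by
  obtain ⟨⟨e, he⟩, hx, hc⟩ := (hι x).surjOn (Set.mem_univ c)
  obtain ⟨y, rfl⟩ := Sym2.mem_iff_exists.1 (show x ∈ e from hx)
  exact ⟨y, he, hc⟩

/-- The neighbour of `x` along the edge of colour `c` in the star of `x`. -/
noncomputable def IsLegalColoring.neighbor (hι : IsLegalColoring ι) (x : V) (c : Fin d) : V :=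
  (hι.exists_neighbor x c).choose

lemma IsLegalColoring.adj_neighbor (hι : IsLegalColoring ι) (x : V) (c : Fin d) :
    T.Adj x (hι.neighbor x c) :=
  (hι.exists_neighbor x c).choose_spec.choose

lemma IsLegalColoring.color_neighbor (hι : IsLegalColoring ι) (x : V) (c : Fin d) :
    ι ⟨s(x, hι.neighbor x c), hι.adj_neighbor x c⟩ = c :=
  (hι.exists_neighbor x c).choose_spec.choose_spec

lemma IsLegalColoring.neighbor_color (hι : IsLegalColoring ι) {x y : V} (h : T.Adj x y) :
    hι.neighbor x (ι ⟨s(x, y), h⟩) = y := by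
  have h1 := (hι x).injOn (x₁ := ⟨s(x, hι.neighbor x (ι ⟨s(x, y), h⟩)), hι.adj_neighbor x (ι ⟨s(x, y), h⟩)⟩)
    (x₂ := ⟨s(x, y), h⟩) (Sym2.mem_mk_left _ _) (Sym2.mem_mk_left _ _) (hι.color_neighbor _ _)
  exact Sym2.congr_right.1 (Subtype.mk.inj h1)

lemma IsLegalColoring.exists_eq_neighbor (hι : IsLegalColoring ι) {x y : V} (h : T.Adj x y) :
    ∃ c, y = hι.neighbor x c :=
  ⟨_, (hι.neighbor_color h).symm⟩

lemma IsLegalColoring.neighbor_neighbor (hι : IsLegalColoring ι) (x : V) (c : Fin d) :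
    hι.neighbor (hι.neighbor x c) c = x := by
  have h := hι.neighbor_color (hι.adj_neighbor x c).symm
  have h1 : ι ⟨s(hι.neighbor x c, x), (hι.adj_neighbor x c).symm⟩ = c := by
    conv_rhs => rw [← hι.color_neighbor x c]
    congr 2
    exact Sym2.eq_swap
  rwa [h1] at h

lemma IsLegalColoring.neighbor_injective (hι : IsLegalColoring ι) (x : V) :
    Function.Injective (hι.neighbor x) := by
  intro c c' h
  rw [← hι.color_neighbor x c, ← hι.color_neighbor x c']
  congr 3

/-- Membership in `U(F)` in terms of neighbours: every local action lies in `F`. -/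
lemma mem_universalGroup_iff (hι : IsLegalColoring ι) {g : T ≃g T} :
    g ∈ universalGroup ι F ↔
      ∀ x, ∃ σ ∈ F, ∀ c, g (hι.neighbor x c) = hι.neighbor (g x) (σ c) := by
  refine forall_congr' fun x => exists_congr fun σ => and_congr_right fun _ => ?_
  constructor
  · intro h c
    have h1 := h ⟨s(x, hι.neighbor x c), hι.adj_neighbor x c⟩ (Sym2.mem_mk_left _ _)
    rw [hι.color_neighbor] at h1
    rw [← h1]
    exact (hι.neighbor_color (g.map_rel_iff.2 (hι.adj_neighbor x c))).symm
  · rintro h ⟨e, he⟩ hx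
    obtain ⟨y, rfl⟩ := Sym2.mem_iff_exists.1 (show x ∈ e from hx)
    have h1 := h (ι ⟨s(x, y), he⟩)
    rw [hι.neighbor_color he] at h1
    apply hι.neighbor_injective (g x)
    rw [← h1]
    exact hι.neighbor_color (g.map_rel_iff.2 he)

/-- A permutation of the vertices all of whose local actions lie in `F` is an automorphism in
`U(F)`. -/
lemma exists_mem_universalGroup_of_equiv (hι : IsLegalColoring ι) (e : V ≃ V)
    (he : ∀ x, ∃ σ ∈ F, ∀ c, e (hι.neighbor x c) = hι.neighbor (e x) (σ c)) :
    ∃ g ∈ universalGroup ι F, ∀ v, g v = e v := by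
  refine ⟨⟨e, ?_⟩, (mem_universalGroup_iff hι).2 he, fun _ => rfl⟩
  intro u v
  obtain ⟨σ, -, hσ⟩ := he u
  constructor
  · intro h
    obtain ⟨c, hc⟩ := hι.exists_eq_neighbor h
    have : e v = e (hι.neighbor u (σ.symm c)) := by rw [hσ, hc, Equiv.apply_symm_apply]
    rw [e.injective this]
    exact hι.adj_neighbor _ _
  · intro h
    obtain ⟨c, rfl⟩ := hι.exists_eq_neighbor h
    rw [hσ]
    exact hι.adj_neighbor _ _

/-- A property of vertices that passes to neighbours holds everywhere once it holds somewhere. -/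
lemma forall_of_forall_neighbor (hT : T.IsTree) (hι : IsLegalColoring ι) {P : V → Prop} (x : V)
    (hx : P x) (h : ∀ v c, P v → P (hι.neighbor v c)) (v : V) : P v := by
  obtain ⟨p⟩ := hT.connected x v
  induction p with
  | nil => exact hx
  | cons hadj _ ih =>
    obtain ⟨c, rfl⟩ := hι.exists_eq_neighbor hadj
    exact ih (h _ _ hx)

/-- A self-map of the vertices fixing `x` with prescribed constant local action `σ`: it is
built outwards from `x`, sending `v` to the neighbour of the image of the parent of `v`. -/
lemma exists_map_neighbor_eq (hT : T.IsTree) (hι : IsLegalColoring ι) (x : V)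
    (σ : Equiv.Perm (Fin d)) :
    ∃ φ : V → V, φ x = x ∧ ∀ v c, φ (hι.neighbor v c) = hι.neighbor (φ v) (σ c) := by
  have hpar : ∀ v, x ≠ v → ∃ c, T.dist x v = T.dist x (hι.neighbor v c) + 1 := by
    intro v hv
    obtain ⟨w, hvw, h⟩ := exists_adj_dist_eq_add_one hT hv
    obtain ⟨c, rfl⟩ := hι.exists_eq_neighbor hvw
    exact ⟨c, h⟩
  -- `ψ n` is the correct map on the sphere of radius `n` about `x`.
  have hψ : ∃ ψ : ℕ → V → V, ψ 0 x = x ∧ ∀ n v c, T.dist x v = n + 1 →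
      T.dist x (hι.neighbor v c) = n →
      ψ (n + 1) v = hι.neighbor (ψ n (hι.neighbor v c)) (σ c) := by
    classical
    let ψ : ℕ → V → V := fun n => Nat.rec id (fun _ f v =>
      if h : x ≠ v then hι.neighbor (f (hι.neighbor v (hpar v h).choose)) (σ (hpar v h).choose)
      else v) n
    refine ⟨ψ, rfl, fun n v c h1 h2 => ?_⟩
    have hv : x ≠ v := by
      rintro rfl
      simp at h1
    have hc : (hpar v hv).choose = c := by
      apply hι.neighbor_injective v
      refine eq_of_adj_of_dist_eq_add_one hT (s := x) (hι.adj_neighbor _ _)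
        (hι.adj_neighbor _ _) (hpar v hv).choose_spec ?_
      rw [h1, h2]
    change (if h : x ≠ v then _ else _) = _
    rw [dif_pos hv, hc]
  obtain ⟨ψ, hψ0, hψ⟩ := hψ
  refine ⟨fun v => ψ (T.dist x v) v, by simpa using hψ0, fun v c => ?_⟩
  rcases hT.dist_eq_dist_add_one_of_adj x (hι.adj_neighbor v c) with h | h
  · beta_reduce
    rw [h, hψ _ v c h rfl, hι.neighbor_neighbor]
  · have h1 := hψ _ (hι.neighbor v c) c h (by rw [hι.neighbor_neighbor])
    rw [hι.neighbor_neighbor] at h1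
    beta_reduce
    rw [h, h1]

/-- Every `σ ∈ F` is the local action, at every vertex, of an element of `U(F)` fixing `x`. -/
lemma exists_mem_universalGroup_constant (hT : T.IsTree) (hι : IsLegalColoring ι) (x : V)
    {σ : Equiv.Perm (Fin d)} (hσ : σ ∈ F) :
    ∃ g ∈ universalGroup ι F, g x = x ∧ ∀ v c, g (hι.neighbor v c) = hι.neighbor (g v) (σ c) := by
  obtain ⟨φ, hφx, hφ⟩ := exists_map_neighbor_eq hT hι x σ
  obtain ⟨φ', hφx', hφ'⟩ := exists_map_neighbor_eq hT hι x σ.symm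
  let e : V ≃ V :=
    { toFun := φ
      invFun := φ'
      left_inv := forall_of_forall_neighbor hT hι x (by rw [hφx, hφx'])
        fun v c h => by rw [hφ, hφ', h, Equiv.symm_apply_apply]
      right_inv := forall_of_forall_neighbor hT hι x (by rw [hφx', hφx])
        fun v c h => by rw [hφ', hφ, h, Equiv.apply_symm_apply] }
  obtain ⟨g, hg, hge⟩ := exists_mem_universalGroup_of_equiv hι e fun v => ⟨σ, hσ, hφ v⟩
  have hgφ : ∀ v, g v = φ v := hge
  exact ⟨g, hg, by rw [hgφ, hφx], fun v c => by rw [hgφ, hgφ, hφ]⟩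

/-- Independence: an element of `U(F)` fixing an edge may be replaced by the identity on one of
the two half-trees of that edge. -/
lemma exists_mem_universalGroup_eqOn_halfTree (hT : T.IsTree) (hι : IsLegalColoring ι)
    {x y : V} (hxy : T.Adj x y) {g : T ≃g T} (hg : g ∈ universalGroup ι F) (hgx : g x = x)
    (hgy : g y = y) :
    ∃ h ∈ universalGroup ι F, (∀ v ∈ halfTree T x y, h v = g v) ∧
      ∀ v ∉ halfTree T x y, h v = v := by
  classical
  have hmem : ∀ v, g v ∈ halfTree T x y ↔ v ∈ halfTree T x y := fun v => by
    have := apply_mem_halfTree_iff hT g (x := x) (y := y) (v := v)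
    rwa [hgx, hgy] at this
  have hmem' : ∀ v, g.symm v ∈ halfTree T x y ↔ v ∈ halfTree T x y := fun v => by
    rw [← hmem, RelIso.apply_symm_apply]
  let e : V ≃ V :=
    { toFun := fun v => if v ∈ halfTree T x y then g v else v
      invFun := fun v => if v ∈ halfTree T x y then g.symm v else v
      left_inv := fun v => by
        by_cases hv : v ∈ halfTree T x y <;> simp [hv, hmem]
      right_inv := fun v => by
        by_cases hv : v ∈ halfTree T x y <;> simp [hv, hmem'] }
  have he1 : ∀ v ∈ halfTree T x y, e v = g v := fun v hv => if_pos hv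
  have he2 : ∀ v ∉ halfTree T x y, e v = v := fun v hv => if_neg hv
  obtain ⟨h, hh, hhe⟩ := exists_mem_universalGroup_of_equiv (F := F) hι e (by
    intro v
    by_cases hv : v ∈ halfTree T x y
    · obtain ⟨σ, hσ, hgσ⟩ := (mem_universalGroup_iff hι).1 hg v
      refine ⟨σ, hσ, fun c => ?_⟩
      rw [he1 v hv, ← hgσ]
      by_cases hw : hι.neighbor v c ∈ halfTree T x y
      · exact he1 _ hw
      · obtain ⟨-, hwx⟩ :=
          eq_and_eq_of_adj_of_mem_halfTree hT hxy (hι.adj_neighbor v c) hv hw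
        rw [he2 _ hw, hwx, hgx]
    · refine ⟨1, F.one_mem, fun c => ?_⟩
      rw [he2 v hv, Equiv.Perm.one_apply]
      by_cases hw : hι.neighbor v c ∈ halfTree T x y
      · obtain ⟨hwy, -⟩ :=
          eq_and_eq_of_adj_of_mem_halfTree hT hxy (hι.adj_neighbor v c).symm hw hv
        rw [he1 _ hw, hwy, hgy]
      · exact he2 _ hw)
  exact ⟨h, hh, fun v hv => by rw [hhe, he1 v hv], fun v hv => by rw [hhe, he2 v hv]⟩

end Coloring

/-! ### Point stabilizers of a primitive permutation group -/

section Primitive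

open scoped Pointwise in
/-- Two distinct point stabilizers of a primitive group generate it, unless the group acts freely:
stabilizers are maximal, and the points with a given stabilizer form a block. -/
lemma le_of_stabilizers_le_or_eq_one {F : Subgroup (Equiv.Perm (Fin d))}
    (hF : MulAction.IsPreprimitive F (Fin d)) :
    (∀ c₁ c₂ : Fin d, c₁ ≠ c₂ → ∀ K : Subgroup (Equiv.Perm (Fin d)),
      (∀ σ ∈ F, σ c₁ = c₁ → σ ∈ K) → (∀ σ ∈ F, σ c₂ = c₂ → σ ∈ K) → F ≤ K) ∨
    ∀ σ ∈ F, ∀ c, σ c = c → σ = 1 := by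
  by_contra! hcon
  obtain ⟨⟨c₁, c₂, hne, K, h1, h2, hK⟩, σ, hσ, c, hσc, hσ1⟩ := hcon
  have : Nontrivial (Fin d) := ⟨c₁, c₂, hne⟩
  have hco : ∀ c : Fin d, IsCoatom (MulAction.stabilizer F c) := fun c =>
    hF.isCoatom_stabilizer_of_isPreprimitive F c
  have hle : ∀ c, (∀ σ ∈ F, σ c = c → σ ∈ K) → MulAction.stabilizer F c = K.subgroupOf F := by
    intro c hc
    have hle : MulAction.stabilizer F c ≤ K.subgroupOf F := fun σ hσ => by
      rw [Subgroup.mem_subgroupOf]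
      exact hc σ σ.2 hσ
    refine ((hco c).le_iff.1 hle).resolve_left (fun htop => ?_) |>.symm
    exact hK (Subgroup.subgroupOf_eq_top.1 htop)
  have hB : MulAction.IsBlock F
      {c : Fin d | MulAction.stabilizer F c = MulAction.stabilizer F c₁} := by
    rw [MulAction.isBlock_iff_smul_eq_smul_of_nonempty]
    have hmem : ∀ (g : F) (c : Fin d),
        c ∈ g • {c : Fin d | MulAction.stabilizer F c = MulAction.stabilizer F c₁} ↔
          MulAction.stabilizer F c =
            (MulAction.stabilizer F c₁).map (MulAut.conj g).toMonoidHom := by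
      intro g c
      rw [Set.mem_smul_set_iff_inv_smul_mem, Set.mem_ofPred_eq,
        MulAction.stabilizer_smul_eq_stabilizer_map_conj]
      constructor
      · intro h
        rw [← h, Subgroup.map_map]
        ext z
        simp [Subgroup.mem_map, mul_assoc]
      · intro h
        rw [h, Subgroup.map_map]
        ext z
        simp [Subgroup.mem_map, mul_assoc]
    rintro g₁ g₂ ⟨c, hc1, hc2⟩
    rw [hmem] at hc1 hc2
    ext c'
    rw [hmem, hmem, ← hc1, ← hc2]
  have huniv := (hF.isTrivialBlock_of_isBlock hB).resolve_left fun hs =>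
    hne (hs rfl ((hle c₂ h2).trans (hle c₁ h1).symm))
  refine hσ1 (Equiv.ext fun c' => ?_)
  have hall : ∀ c, MulAction.stabilizer F c = MulAction.stabilizer F c₁ := fun c => by
    have : c ∈ (Set.univ : Set (Fin d)) := Set.mem_univ c
    rwa [← huniv] at this
  have hmem : (⟨σ, hσ⟩ : F) ∈ MulAction.stabilizer F c := hσc
  rw [hall, ← hall c'] at hmem
  exact hmem

end Primitive

/-! ### Generation by contraction groups -/

section Generation

variable {ι : T.edgeSet → Fin d} {F : Subgroup (Equiv.Perm (Fin d))}

lemma universalGroupPlus_le : universalGroupPlus ι F ≤ universalGroup ι F :=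
  (Subgroup.closure_le _).2 fun _ hg => hg.1

lemma mem_universalGroupPlus {g : T ≃g T} (hg : g ∈ universalGroup ι F) {x y : V}
    (hxy : T.Adj x y) (hx : g x = x) (hy : g y = y) : g ∈ universalGroupPlus ι F :=
  Subgroup.subset_closure ⟨hg, x, y, hxy, hx, hy⟩

lemma tendsto_one_of_eventually_apply_eq {K : Subgroup (T ≃g T)} {f : ℕ → K}
    (h : ∀ s : V, ∀ᶠ n in atTop, (f n : T ≃g T) s = s) : Tendsto f atTop (𝓝 1) := by
  let _ : TopologicalSpace V := ⊥
  have : DiscreteTopology V := ⟨rfl⟩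
  rw [nhds_induced, tendsto_comap_iff]
  rw [autTopology, nhds_induced, tendsto_comap_iff, tendsto_pi_nhds]
  intro s
  rw [nhds_discrete]
  exact tendsto_pure.2 (h s)

lemma pow_apply_line {x : ℤ → V} {l : ℤ} {a : T ≃g T} (hshift : ∀ k, a (x k) = x (k + l))
    (n : ℕ) (k : ℤ) : (a ^ n) (x k) = x (k + n * l) := by
  induction n generalizing k with
  | zero => simp
  | succ n ih =>
    have : (a ^ (n + 1)) (x k) = (a ^ n) (a (x k)) := by rw [pow_succ]; rfl
    rw [this, hshift, ih]
    congr 1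
    push_cast
    ring

/-- The half-trees containing the repelling end of `a` are pushed by `a ^ n` over the whole
tree, so their pointwise fixators are contracted. -/
lemma mem_contractionMinus_of_fix_halfTree (hT : T.IsTree) {x : ℤ → V} {l : ℤ} (hl : 0 < l)
    (hadj : ∀ k, T.Adj (x k) (x (k + 1))) (hne : ∀ k, x k ≠ x (k + 2))
    {K : Subgroup (T ≃g T)} {a g : K} (hshift : ∀ k, (a : T ≃g T) (x k) = x (k + l)) {k : ℤ}
    (hg : ∀ v ∈ halfTree T (x (k + 1)) (x k), (g : T ≃g T) v = v) :
    g ∈ contractionMinus (fun n : ℕ => a ^ n) := by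
  refine tendsto_one_of_eventually_apply_eq fun s => ?_
  obtain ⟨M, hM⟩ := exists_forall_mem_halfTree hT hadj hne s
  filter_upwards [eventually_ge_atTop (M - k).toNat] with n hn
  have hn' : M ≤ k + n * l := by nlinarith [Int.self_le_toNat (M - k)]
  have hs := hM _ hn'
  have hinv : ((a : T ≃g T) ^ n) (((a : T ≃g T) ^ n)⁻¹ s) = s :=
    RelIso.apply_inv_self _ _
  rw [add_right_comm, ← pow_apply_line hshift, ← pow_apply_line hshift, ← hinv,
    apply_mem_halfTree_iff hT] at hs
  change ((a : T ≃g T) ^ n) ((g : T ≃g T) (((a : T ≃g T) ^ n)⁻¹ s)) = s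
  rw [hg _ hs, hinv]

lemma contractionMinus_inv {G : Type*} [Group G] [TopologicalSpace G] (a : G) :
    contractionMinus (fun n : ℕ => a⁻¹ ^ n) = contractionPlus (fun n : ℕ => a ^ n) := by
  simp [contractionMinus, contractionPlus]

/-- The counterpart of `mem_contractionMinus_of_fix_halfTree` for the attracting end. -/
lemma mem_contractionPlus_of_fix_halfTree (hT : T.IsTree) {x : ℤ → V} {l : ℤ} (hl : 0 < l)
    (hadj : ∀ k, T.Adj (x k) (x (k + 1))) (hne : ∀ k, x k ≠ x (k + 2))
    {K : Subgroup (T ≃g T)} {a g : K} (hshift : ∀ k, (a : T ≃g T) (x k) = x (k + l)) {k : ℤ}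
    (hg : ∀ v ∈ halfTree T (x k) (x (k + 1)), (g : T ≃g T) v = v) :
    g ∈ contractionPlus (fun n : ℕ => a ^ n) := by
  -- reverse the line and replace `a` by its inverse
  rw [← contractionMinus_inv]
  refine mem_contractionMinus_of_fix_halfTree hT (x := fun k => x (-k)) (k := -(k + 1)) hl
    (fun k => ?_) (fun k => ?_) (fun k => ?_) ?_
  · have := (hadj (-(k + 1))).symm
    rwa [show -(k + 1) + 1 = -k by ring] at this
  · have := (hne (-(k + 2))).symm
    rwa [show -(k + 2) + 2 = -k by ring] at this
  · have h := hshift (-(k + l))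
    rw [show -(k + l) + l = -k by ring] at h
    change (a : T ≃g T).symm (x (-k)) = _
    rw [← h, RelIso.symm_apply_apply]
  · have h1 : -(-(k + 1) + 1) = k := by ring
    have h2 : - -(k + 1) = k + 1 := by ring
    simp only [h1, h2]
    exact hg

/-- Spreading from the axis: a subgroup of `U(F)` containing the fixators in `U(F)` of all edges
of a bi-infinite line contains the fixators of all edges, if distinct point stabilizers
generate `F`. Indeed it acts transitively on the star of every vertex of the line, and hence every
edge is a translate of an edge of the line. -/
lemma mem_of_fix_edge (hT : T.IsTree) (hι : IsLegalColoring ι) [MulAction.IsPretransitive F (Fin d)]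
    (hstab : ∀ c₁ c₂ : Fin d, c₁ ≠ c₂ → ∀ K : Subgroup (Equiv.Perm (Fin d)),
      (∀ σ ∈ F, σ c₁ = c₁ → σ ∈ K) → (∀ σ ∈ F, σ c₂ = c₂ → σ ∈ K) → F ≤ K)
    {N : Subgroup (T ≃g T)} (hN : N ≤ universalGroup ι F) {x : ℤ → V}
    (hadj : ∀ k, T.Adj (x k) (x (k + 1))) (hne : ∀ k, x k ≠ x (k + 2))
    (haxis : ∀ k, ∀ g ∈ universalGroup ι F, g (x k) = x k → g (x (k + 1)) = x (k + 1) → g ∈ N)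
    {u v : V} (huv : T.Adj u v) {g : T ≃g T} (hg : g ∈ universalGroup ι F) (hu : g u = u)
    (hv : g v = v) : g ∈ N := by
  have hstar : ∀ k w, T.Adj (x (k + 1)) w →
      ∃ n ∈ N, n (x (k + 1)) = x (k + 1) ∧ n (x (k + 2)) = w := by
    intro k w hw
    have hadj2 : T.Adj (x (k + 1)) (x (k + 2)) := by
      have := hadj (k + 1)
      rwa [add_assoc] at this
    obtain ⟨c₁, hc₁⟩ := hι.exists_eq_neighbor (hadj k).symm
    obtain ⟨c₂, hc₂⟩ := hι.exists_eq_neighbor hadj2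
    obtain ⟨c, rfl⟩ := hι.exists_eq_neighbor hw
    -- the local actions at `x (k + 1)` of the elements of `N` fixing `x (k + 1)`
    let K : Subgroup (Equiv.Perm (Fin d)) :=
      { carrier := {σ | ∃ n ∈ N, n (x (k + 1)) = x (k + 1) ∧
          ∀ c, n (hι.neighbor (x (k + 1)) c) = hι.neighbor (x (k + 1)) (σ c)}
        one_mem' := ⟨1, N.one_mem, rfl, fun _ => rfl⟩
        mul_mem' := by
          rintro σ τ ⟨n, hn, h1, h2⟩ ⟨m, hm, h3, h4⟩
          refine ⟨n * m, N.mul_mem hn hm, ?_, fun c => ?_⟩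
          · change n (m _) = _
            rw [h3, h1]
          · change n (m _) = _
            rw [h4, h2]
            rfl
        inv_mem' := by
          rintro σ ⟨n, hn, h1, h2⟩
          refine ⟨n⁻¹, N.inv_mem hn, ?_, fun c => ?_⟩
          · change n.symm _ = _
            rw [RelIso.symm_apply_eq, h1]
          · change n.symm _ = _
            rw [RelIso.symm_apply_eq, h2]
            exact congrArg _ (σ.apply_symm_apply c).symm }
    have hFK : F ≤ K := by
      refine hstab c₁ c₂ ?_ K (fun σ hσ hc => ?_) (fun σ hσ hc => ?_)
      · rintro rfl
        exact hne k (hc₁.trans hc₂.symm)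
      · obtain ⟨n, hn, hnx, hnσ⟩ := exists_mem_universalGroup_constant hT hι (x (k + 1)) hσ
        refine ⟨n, haxis k n hn ?_ hnx, hnx, fun c => by rw [hnσ, hnx]⟩
        rw [hc₁, hnσ, hnx, hc]
      · obtain ⟨n, hn, hnx, hnσ⟩ := exists_mem_universalGroup_constant hT hι (x (k + 1)) hσ
        refine ⟨n, haxis (k + 1) n hn hnx ?_, hnx, fun c => by rw [hnσ, hnx]⟩
        rw [add_assoc]
        change n (x (k + 2)) = x (k + 2)
        rw [hc₂, hnσ, hnx, hc]
    obtain ⟨⟨σ, hσ⟩, hσc⟩ := MulAction.exists_smul_eq F c₂ c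
    obtain ⟨n, hn, h1, h2⟩ := hFK hσ
    refine ⟨n, hn, h1, ?_⟩
    rw [hc₂, h2]
    exact congrArg _ hσc
  have hedge : ∀ v w, (∃ n ∈ N, ∃ k, n (x (k + 1)) = v) → T.Adj v w →
      ∃ n ∈ N, ∃ k, n (x (k + 1)) = v ∧ n (x (k + 2)) = w := by
    rintro v w ⟨n, hn, k, rfl⟩ hw
    have hw' : T.Adj (x (k + 1)) (n.symm w) := by
      rw [← n.map_rel_iff]
      simpa using hw
    obtain ⟨m, hm, h1, h2⟩ := hstar k _ hw'
    refine ⟨n * m, N.mul_mem hn hm, k, ?_, ?_⟩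
    · change n (m _) = _
      rw [h1]
    · change n (m _) = _
      rw [h2, RelIso.apply_symm_apply]
  have hall : ∀ v, ∃ n ∈ N, ∃ k, n (x (k + 1)) = v := by
    refine forall_of_forall_neighbor hT hι (x (0 + 1)) ⟨1, N.one_mem, 0, rfl⟩ fun v c hv => ?_
    obtain ⟨n, hn, k, -, h⟩ := hedge v _ hv (hι.adj_neighbor v c)
    refine ⟨n, hn, k + 1, ?_⟩
    rw [← h, add_assoc]
    rfl
  obtain ⟨n, hn, k, rfl, rfl⟩ := hedge u v (hall u) huv
  have hmem : n⁻¹ * g * n ∈ N := by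
    refine haxis (k + 1) _ (Subgroup.mul_mem _ (Subgroup.mul_mem _
      (Subgroup.inv_mem _ (hN hn)) hg) (hN hn)) ?_ ?_
    · change n.symm (g (n _)) = _
      rw [hu, RelIso.symm_apply_apply]
    · rw [add_assoc]
      change n.symm (g (n (x (k + 2)))) = x (k + 2)
      rw [hv, RelIso.symm_apply_apply]
  have := N.mul_mem (N.mul_mem hn hmem) (N.inv_mem hn)
  rwa [show n * (n⁻¹ * g * n) * n⁻¹ = g by group] at this

/-- If `F` acts freely on the colours, then `U(F)⁺` is trivial. -/
lemma eq_one_of_mem_universalGroupPlus (hT : T.IsTree) (hι : IsLegalColoring ι)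
    (hfree : ∀ σ ∈ F, ∀ c, σ c = c → σ = 1) {g : T ≃g T} (hg : g ∈ universalGroupPlus ι F) :
    g = 1 := by
  suffices h : universalGroupPlus ι F ≤ ⊥ from Subgroup.mem_bot.1 (h hg)
  refine (Subgroup.closure_le _).2 ?_
  rintro g ⟨hg, x, y, hxy, hx, hy⟩
  have hstep : ∀ u v, T.Adj u v → g u = u → g v = v → ∀ c, g (hι.neighbor u c) =
      hι.neighbor u c := by
    intro u v huv hu hv c
    obtain ⟨σ, hσ, h⟩ := (mem_universalGroup_iff hι).1 hg u
    obtain ⟨c', rfl⟩ := hι.exists_eq_neighbor huv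
    have h1 := h c'
    rw [hu, hv] at h1
    rw [h, hu, hfree σ hσ c' (hι.neighbor_injective u h1).symm, Equiv.Perm.one_apply]
  have hall : ∀ v, g v = v ∧ ∀ c, g (hι.neighbor v c) = hι.neighbor v c := by
    refine forall_of_forall_neighbor hT hι x ⟨hx, hstep x y hxy hx hy⟩ fun v c hv => ?_
    exact ⟨hv.2 c, hstep _ v (hι.adj_neighbor v c).symm (hv.2 c) hv.1⟩
  exact RelIso.ext fun v => (hall v).1

/-- For hyperbolic `a`, the group `U(F)⁺` is generated by the two contraction groups of `a`. -/
theorem closure_contraction_eq_top (hT : T.IsTree) (hι : IsLegalColoring ι)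
    (hF : MulAction.IsPreprimitive F (Fin d)) (a : universalGroupPlus ι F)
    (ha : IsHyperbolic (a : T ≃g T)) :
    Subgroup.closure (contractionPlus (fun n : ℕ => a ^ n) ∪
        contractionMinus (fun n : ℕ => a ^ n)) = ⊤ := by
  obtain ⟨x, l, hl, hadj, hne, hshift⟩ := ha.exists_axis hT
  rcases le_of_stabilizers_le_or_eq_one hF with hstab | hfree
  swap
  · refine absurd ?_ (ha.1 (x 0))
    rw [eq_one_of_mem_universalGroupPlus hT hι hfree a.2]
    rfl
  set M := Subgroup.closure (contractionPlus (fun n : ℕ => a ^ n) ∪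
    contractionMinus (fun n : ℕ => a ^ n)) with hM
  have haxis : ∀ k, ∀ g ∈ universalGroup ι F, g (x k) = x k → g (x (k + 1)) = x (k + 1) →
      g ∈ M.map (universalGroupPlus ι F).subtype := by
    intro k g hg h0 h1
    -- write `g = h * (h⁻¹ * g)`, with factors supported on the two half-trees of the edge
    obtain ⟨h, hh, hh1, hh2⟩ := exists_mem_universalGroup_eqOn_halfTree hT hι (hadj k) hg h0 h1
    have hx0 : x k ∉ halfTree T (x k) (x (k + 1)) := by simp [mem_halfTree]
    have hx1 : x (k + 1) ∉ halfTree T (x (k + 1)) (x k) := by simp [mem_halfTree]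
    have hhG : h ∈ universalGroupPlus ι F := by
      refine mem_universalGroupPlus hh (hadj k) (hh2 _ hx0) ?_
      rw [hh1 _ ((notMem_halfTree_iff hT (hadj k).symm).1 hx1), h1]
    have hgG : g ∈ universalGroupPlus ι F := mem_universalGroupPlus hg (hadj k) h0 h1
    have hmem : (⟨h, hhG⟩ : universalGroupPlus ι F) ∈ M := by
      refine Subgroup.subset_closure (Or.inr ?_)
      exact mem_contractionMinus_of_fix_halfTree hT hl hadj hne hshift fun v hv =>
        hh2 v ((notMem_halfTree_iff hT (hadj k)).2 hv)
    have hmem' : (⟨h, hhG⟩⁻¹ * ⟨g, hgG⟩ : universalGroupPlus ι F) ∈ M := by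
      refine Subgroup.subset_closure (Or.inl ?_)
      refine mem_contractionPlus_of_fix_halfTree hT hl hadj hne hshift (k := k) fun v hv => ?_
      change h.symm (g v) = v
      rw [← hh1 v hv, RelIso.symm_apply_apply]
    refine ⟨_, M.mul_mem hmem hmem', ?_⟩
    rw [mul_inv_cancel_left]
    rfl
  have hMU : M.map (universalGroupPlus ι F).subtype ≤ universalGroup ι F := by
    refine le_trans ?_ universalGroupPlus_le
    rintro _ ⟨g, -, rfl⟩
    exact g.2
  have hle : universalGroupPlus ι F ≤ M.map (universalGroupPlus ι F).subtype := by
    refine (Subgroup.closure_le _).2 ?_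
    rintro g ⟨hg, u, v, huv, hu, hv⟩
    exact mem_of_fix_edge hT hι hstab hMU hadj hne haxis huv hg hu hv
  refine (Subgroup.eq_top_iff' M).2 fun g => ?_
  obtain ⟨g', hg', h⟩ := hle g.2
  rwa [← Subtype.ext h]

end Generation

end BurgerMozes

theorem mainTheorem5 {V : Type*} (T : SimpleGraph V) [T.LocallyFinite] (hT : T.IsTree)
    (d : ℕ) (hd : 3 ≤ d) (hreg : T.IsRegularOfDegree d)
    (ι : T.edgeSet → Fin d) (hι : BurgerMozes.IsLegalColoring ι)
    (F : Subgroup (Equiv.Perm (Fin d))) (hF : MulAction.IsPreprimitive F (Fin d))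
    (a : BurgerMozes.universalGroupPlus ι F) (ha : BurgerMozes.IsHyperbolic (a : T ≃g T)) :
    Subgroup.closure (BurgerMozes.contractionPlus (fun n : ℕ => a ^ n) ∪
        BurgerMozes.contractionMinus (fun n : ℕ => a ^ n)) = ⊤ ∧
    ∀ (H : Type*) [NormedAddCommGroup H] [InnerProductSpace ℂ H] [CompleteSpace H]
      (π : BurgerMozes.universalGroupPlus ι F →* (H ≃ₗᵢ[ℂ] H)),
      BurgerMozes.IsUnitaryRep π →
      (∀ v : H, (∀ g : BurgerMozes.universalGroupPlus ι F, π g v = v) → v = 0) →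
      ∀ v w : H, Tendsto (fun n : ℕ => inner ℂ (π (a ^ n) v) w) atTop (𝓝 0) := by
  have hgen := BurgerMozes.closure_contraction_eq_top hT hι hF a ha
  exact ⟨hgen, fun H _ _ _ π hπ hinv v w =>
    BurgerMozes.tendsto_inner_rep_pow_zero hπ a hgen hinv v w⟩
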